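/- Let $d,N\ge 1$, let $X=(x^1,\dots,x^N)$ be a finite collection of points of $\mathbb R^d$ (repetitions allowed and counted with multiplicity), and let $p\in(0,1)$ with $pN\notin\mathbb Z$. Let $C=\{Y^{T}y : y\ge 0\}\subseteq\mathbb R^d$ (with $Y\in\mathbb R^{r\times d}$) be a polyhedral convex cone containing no line, and let $c$ be an interior point of $C$ with $c_d\neq 0$. Put $$C^+=\{w\in\mathbb R^d : w^Tz\ge 0\ \text{for all } z\in C\}=\{w : Yw\ge 0\},\qquad B^+=\{w\in C^+ : c^Tw=1\}.$$ For univariate data $a=(a_1,\dots,a_N)\in\mathbb R^N$ let $$q^-_a(p)=\min\{s\in\{a_1,\dots,a_N\} : \#\{i : a_i\le s\}\ge\lceil Np\rceil\},\qquad \phi_a(t)=\sum_{i=1}^N\bigl(p\,(a_i-t)^+ + (1-p)\,(a_i-t)^-\bigr),$$ where $y^+=\max\{0,y\}$ and $y^-=\max\{0,-y\}$. For $w\in\mathbb R^d$ write $w^TX=(w^Tx^1,\dots,w^Tx^N)$. The empirical lower $C$-quantile of $X$ is $$Q^-_{X,C}(p)=\bigcap_{w\in C^+}\{z\in\mathbb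 R^d : w^Tz\ge q^-_{w^TX}(p)\}.$$ The geometric dual vector linear program (VLP$^*$) has the feasible set $T=B^+\times\mathbb R$, the objective $$D(w,t)=\Bigl(\tfrac{c_d}{|c_d|}w_1,\dots,\tfrac{c_d}{|c_d|}w_{d-1},\ \phi_{w^TX}(t)\Bigr)^T\in\mathbb R^d,$$ to be minimized with respect to the ordering cone $K=\{y\in\mathbb R^d : y_1=\dots=y_{d-1}=0,\ y_d\ge 0\}$, and the extended image $\mathcal D=D[T]+K$. An (optimal) solution of (VLP$^*$) is a finite set $S\subseteq T$ such that every vertex of $\mathcal D$ belongs to $D[S]$; it is irredundant if no point of $S$ can be omitted without losing this property. Then (VLP$^*$) has a unique irredundant optimal solution $\bar T$, and $$Q^-_{X,C}(p)=\bigcap_{(w,t)\in\bar T}\{z\in\mathbb R^d : w^Tz\ge t\}.$$ -/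

import Mathlib

open scoped Pointwise Matrix

namespace ConeQuantile

noncomputable section

/-- The empirical lower `p`-quantile of the univariate data `x 1, …, x N`, counted with
multiplicity: the least data point `s` such that at least `⌈N p⌉` of the data are `≤ s`. -/
def lowerQuantile {N : ℕ} (x : Fin N → ℝ) (p : ℝ) : ℝ :=
  sInf {s : ℝ | (∃ i, x i = s) ∧
    ⌈(N : ℝ) * p⌉ ≤ ((Finset.univ.filter fun j => x j ≤ s).card : ℤ)}

/-- For at least one data point and `p ≤ 1`, the infimum above is a genuine minimum. -/
theorem isLeast_lowerQuantile {N : ℕ} (hN : 0 < N) (x : Fin N → ℝ) {p : ℝ} (hp : p ≤ 1) :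
    IsLeast {s : ℝ | (∃ i, x i = s) ∧
      ⌈(N : ℝ) * p⌉ ≤ ((Finset.univ.filter fun j => x j ≤ s).card : ℤ)}
      (lowerQuantile x p) := by
  have hfin : {s : ℝ | (∃ i, x i = s) ∧
      ⌈(N : ℝ) * p⌉ ≤ ((Finset.univ.filter fun j => x j ≤ s).card : ℤ)}.Finite :=
    (Set.finite_range x).subset fun s hs => hs.1
  haveI : Nonempty (Fin N) := ⟨⟨0, hN⟩⟩
  obtain ⟨i, hi⟩ := Finite.exists_max x
  have hne : {s : ℝ | (∃ i, x i = s) ∧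
      ⌈(N : ℝ) * p⌉ ≤ ((Finset.univ.filter fun j => x j ≤ s).card : ℤ)}.Nonempty := by
    refine ⟨x i, ⟨i, rfl⟩, ?_⟩
    rw [Finset.filter_true_of_mem fun j _ => hi j, Finset.card_univ, Fintype.card_fin, Int.ceil_le]
    push_cast
    exact mul_le_of_le_one_right (Nat.cast_nonneg N) hp
  exact ⟨hne.csInf_mem hfin, fun s hs => csInf_le hfin.bddBelow hs⟩

/-- The univariate dual objective
`φ_x(t) = ∑ i, (p (x i - t)⁺ + (1 - p) (x i - t)⁻)`. -/
def quantileObjective {N : ℕ} (x : Fin N → ℝ) (p t : ℝ) : ℝ :=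
  ∑ i, (p * max 0 (x i - t) + (1 - p) * max 0 (-(x i - t)))

/-- The scalar data `wᵀX = (wᵀx 1, …, wᵀx N)`. -/
def scalarData {N d : ℕ} (X : Fin N → Fin d → ℝ) (w : Fin d → ℝ) : Fin N → ℝ :=
  fun i => w ⬝ᵥ X i

/-- The cone `{Yᵀ y | y ≥ 0}` generated by the rows of `Y`. -/
def rowCone {r d : ℕ} (Y : Matrix (Fin r) (Fin d) ℝ) : Set (Fin d → ℝ) :=
  {z | ∃ y : Fin r → ℝ, 0 ≤ y ∧ z = Yᵀ *ᵥ y}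

/-- A polyhedral convex cone in `ℝ^d`. -/
def IsPolyhedralCone {d : ℕ} (C : Set (Fin d → ℝ)) : Prop :=
  ∃ (r : ℕ) (Y : Matrix (Fin r) (Fin d) ℝ), C = rowCone Y

/-- `C` contains no line. -/
def IsLineFree {d : ℕ} (C : Set (Fin d → ℝ)) : Prop :=
  ∀ a v : Fin d → ℝ, (∀ s : ℝ, a + s • v ∈ C) → v = 0

/-- The dual cone `C⁺`. -/
def dualCone {d : ℕ} (C : Set (Fin d → ℝ)) : Set (Fin d → ℝ) :=
  {w | ∀ z ∈ C, 0 ≤ w ⬝ᵥ z}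

/-- For `C = {Yᵀ y | y ≥ 0}` the dual cone is `{w | Y w ≥ 0}`. -/
theorem dualCone_rowCone {r d : ℕ} (Y : Matrix (Fin r) (Fin d) ℝ) :
    dualCone (rowCone Y) = {w | 0 ≤ Y *ᵥ w} := by
  have key : ∀ (w : Fin d → ℝ) (y : Fin r → ℝ), w ⬝ᵥ (Yᵀ *ᵥ y) = y ⬝ᵥ (Y *ᵥ w) := by
    intro w y
    rw [Matrix.dotProduct_mulVec, Matrix.vecMul_transpose, dotProduct_comm]
  ext w
  constructor
  · intro h j
    have h1 := h (Yᵀ *ᵥ Pi.single j 1) ⟨Pi.single j 1, by simp [Pi.single_nonneg], rfl⟩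
    rw [key] at h1
    simpa using h1
  · rintro h z ⟨y, hy, rfl⟩
    rw [key]
    exact dotProduct_nonneg_of_nonneg hy h

/-- The base `B⁺ = {w ∈ C⁺ | cᵀ w = 1}` of the dual cone. -/
def dualBase {d : ℕ} (C : Set (Fin d → ℝ)) (c : Fin d → ℝ) : Set (Fin d → ℝ) :=
  {w | w ∈ dualCone C ∧ c ⬝ᵥ w = 1}

/-- The empirical lower `C`-quantile `Q⁻_{X,C}(p)`. -/
def lowerConeQuantile {N d : ℕ} (X : Fin N → Fin d → ℝ) (C : Set (Fin d → ℝ)) (p : ℝ) :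
    Set (Fin d → ℝ) :=
  ⋂ w ∈ dualCone C, {z | lowerQuantile (scalarData X w) p ≤ w ⬝ᵥ z}

/-! The geometric dual problem `(VLP*)`, in dimension `d = n + 1`, so that the last
component of a vector exists. -/

/-- The feasible set `T = B⁺ × ℝ`. -/
def dualFeasible {n : ℕ} (C : Set (Fin (n + 1) → ℝ)) (c : Fin (n + 1) → ℝ) :
    Set ((Fin (n + 1) → ℝ) × ℝ) :=
  dualBase C c ×ˢ Set.univ

/-- The objective `D(w, t)`: its first `d - 1` components are `(c_d / |c_d|) w_j` and its last
component is `φ_{wᵀX}(t)`. -/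
def dualObjective {N n : ℕ} (X : Fin N → Fin (n + 1) → ℝ) (p : ℝ) (c : Fin (n + 1) → ℝ)
    (a : (Fin (n + 1) → ℝ) × ℝ) : Fin (n + 1) → ℝ :=
  Fin.snoc (α := fun _ => ℝ)
    (fun j : Fin n => c (Fin.last n) / |c (Fin.last n)| * a.1 j.castSucc)
    (quantileObjective (scalarData X a.1) p a.2)

/-- The ordering cone `K = {y | y_1 = … = y_{d-1} = 0, y_d ≥ 0}`. -/
def dualOrderingCone (n : ℕ) : Set (Fin (n + 1) → ℝ) :=
  {y | (∀ j : Fin n, y j.castSucc = 0) ∧ 0 ≤ y (Fin.last n)}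

/-- The extended image `𝒟 = D[T] + K`. -/
def extendedImage {N n : ℕ} (X : Fin N → Fin (n + 1) → ℝ) (p : ℝ)
    (C : Set (Fin (n + 1) → ℝ)) (c : Fin (n + 1) → ℝ) : Set (Fin (n + 1) → ℝ) :=
  dualObjective X p c '' dualFeasible C c + dualOrderingCone n

/-- `S` is an (optimal) solution of `(VLP*)`: a finite set of feasible points whose objective
values cover all vertices of the extended image. -/
def IsDualSolution {N n : ℕ} (X : Fin N → Fin (n + 1) → ℝ) (p : ℝ)
    (C : Set (Fin (n + 1) → ℝ)) (c : Fin (n + 1) → ℝ)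
    (S : Set ((Fin (n + 1) → ℝ) × ℝ)) : Prop :=
  S.Finite ∧ S ⊆ dualFeasible C c ∧
    (extendedImage X p C c).extremePoints ℝ ⊆ dualObjective X p c '' S

/-- `S` is an irredundant solution of `(VLP*)`: no point can be omitted. -/
def IsIrredundantDualSolution {N n : ℕ} (X : Fin N → Fin (n + 1) → ℝ) (p : ℝ)
    (C : Set (Fin (n + 1) → ℝ)) (c : Fin (n + 1) → ℝ)
    (S : Set ((Fin (n + 1) → ℝ) × ℝ)) : Prop :=
  IsDualSolution X p C c S ∧ ∀ a ∈ S, ¬ IsDualSolution X p C c (S \ {a})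

end

end ConeQuantile

open ConeQuantile

/-! ### Vertices of a convex hull plus a cone -/

section ConvexGeometry

variable {E : Type*} [AddCommGroup E] [Module ℝ E]

/-! Since `pN` is not an integer, `φ_a` has a unique minimizer, the lower quantile of `a`. Write
`q(w)` for the quantile of `wᵀX`. As `c_d ≠ 0`, a point `w` of `B⁺` is determined by its first `d -
1` coordinates, so a vertex of `𝒟` comes from exactly one feasible point, necessarily with `t =
q(w)`. These points form the only possible irredundant solution, `vertexSolution`.

Finiteness comes from cutting the polytope `B⁺` into finitely many cells by the order of the data
`wᵀxⁱ`. On a cell the objective at a fixed data point is linear, so `𝒟` is the hull of a finite set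
plus the pointed cone `K`, hence the hull of its vertices plus `K`.

For the formula, fix `z` satisfying the vertex inequalities and let `U` be the feasible `(w, t)`
with `t ≤ wᵀz`. By joint convexity of `φ`, `D[U] + K` is convex; it contains all vertices, hence all
of `𝒟`. Applied to `D(w, q(w))`, uniqueness of the minimizer gives `(w, q(w)) ∈ U`. Positive
homogeneity passes from `B⁺` to `C⁺`. -/

theorem eq_zero_of_add_mem_extremePoints {A : Set E} {a k : E} (ha : a ∈ A)
    (hk : a + (2 : ℝ) • k ∈ A) (hx : a + k ∈ A.extremePoints ℝ) : k = 0 := by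
  -- `a + k` is the midpoint of `a` and `a + 2k`.
  have h := hx.2 ha hk ⟨1 / 2, 1 / 2, by norm_num, by norm_num, by norm_num, by module⟩
  simpa using h

theorem extremePoints_convexHull_add_cone_subset {F : Set E} (K : PointedCone ℝ E) :
    (convexHull ℝ F + (K : Set E)).extremePoints ℝ ⊆ F := by
  intro x hx
  obtain ⟨a, ha, k, hk, rfl⟩ := Set.mem_add.1 hx.1
  have h0 : k = 0 := eq_zero_of_add_mem_extremePoints
    (Set.mem_add.2 ⟨a, ha, 0, K.zero_mem, add_zero a⟩)
    (Set.mem_add.2 ⟨a, ha, _, K.smul_mem (by norm_num) hk, rfl⟩) hx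
  subst h0
  rw [add_zero] at hx ⊢
  refine extremePoints_convexHull_subset (inter_extremePoints_subset_extremePoints_of_subset
    (fun y hy => Set.mem_add.2 ⟨y, hy, 0, K.zero_mem, add_zero y⟩) ⟨ha, hx⟩)

/-- If `v` lies between two points of the set, average their weights. A total weight below 1 on `v`
could be solved for `v`, contradicting `hmin`; so all weight sits on `v`, the cone parts cancel, and
pointedness kills them. -/
theorem mem_extremePoints_convexHull_add_cone [DecidableEq E] {F : Finset E} {K : PointedCone ℝ E}
    (hK : ∀ x ∈ K, -x ∈ K → x = 0) {v : E} (hv : v ∈ F)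
    (hmin : v ∉ convexHull ℝ (F.erase v : Set E) + (K : Set E)) :
    v ∈ (convexHull ℝ (F : Set E) + (K : Set E)).extremePoints ℝ := by
  have smulK : ∀ {r : ℝ} {k : E}, 0 ≤ r → k ∈ K → r • k ∈ K := fun {r k} hr hk =>
    K.smul_mem hr hk
  refine ⟨Set.mem_add.2 ⟨v, subset_convexHull ℝ _ hv, 0, K.zero_mem, add_zero v⟩, ?_⟩
  rintro x hx y hy ⟨α, β, hα, hβ, hαβ, hxy⟩
  obtain ⟨x', hx', k, hk, rfl⟩ := Set.mem_add.1 hx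
  obtain ⟨y', hy', l, hl, rfl⟩ := Set.mem_add.1 hy
  obtain ⟨f, hf0, hf1, rfl⟩ := Finset.mem_convexHull'.1 hx'
  obtain ⟨g, hg0, hg1, rfl⟩ := Finset.mem_convexHull'.1 hy'
  have hm : α • k + β • l ∈ K := K.add_mem (smulK hα.le hk) (smulK hβ.le hl)
  set h : E → ℝ := fun u => α * f u + β * g u with hh
  have hh0 : ∀ u ∈ F, 0 ≤ h u := fun u hu =>
    add_nonneg (mul_nonneg hα.le (hf0 u hu)) (mul_nonneg hβ.le (hg0 u hu))
  have hh1 : ∑ u ∈ F, h u = 1 := by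
    simp only [hh, Finset.sum_add_distrib, ← Finset.mul_sum, hf1, hg1, mul_one, hαβ]
  have hsum : ∑ u ∈ F, h u • u + (α • k + β • l) = v := by
    rw [← hxy]
    simp only [hh, add_smul, mul_smul, Finset.sum_add_distrib, ← Finset.smul_sum, smul_add]
    abel
  have he1 : ∑ u ∈ F.erase v, h u = 1 - h v := by
    rw [← hh1, ← Finset.add_sum_erase F h hv]; ring
  have he : ∑ u ∈ F.erase v, h u • u + (α • k + β • l) = (1 - h v) • v := by
    rw [← Finset.add_sum_erase F _ hv] at hsum
    rw [sub_smul, one_smul, eq_sub_iff_add_eq]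
    conv_rhs => rw [← hsum]
    abel
  have hv1 : h v = 1 := by
    by_contra hne
    have hle : 0 ≤ 1 - h v := he1 ▸ Finset.sum_nonneg fun u hu => hh0 u (Finset.mem_of_mem_erase hu)
    have hpos : 0 < 1 - h v := lt_of_le_of_ne hle fun h' => hne (by linarith)
    refine hmin (Set.mem_add.2 ⟨∑ u ∈ F.erase v, ((1 - h v)⁻¹ * h u) • u,
      Finset.mem_convexHull'.2 ⟨fun u => (1 - h v)⁻¹ * h u, fun u hu => mul_nonneg (by positivity)
        (hh0 u (Finset.mem_of_mem_erase hu)), ?_, rfl⟩,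
      (1 - h v)⁻¹ • (α • k + β • l), smulK (by positivity) hm, ?_⟩)
    · rw [← Finset.mul_sum, he1, inv_mul_cancel₀ hpos.ne']
    · simp only [mul_smul, ← Finset.smul_sum]
      rw [← smul_add, he, smul_smul, inv_mul_cancel₀ hpos.ne', one_smul]
  have hzero : ∀ u ∈ F.erase v, h u = 0 :=
    (Finset.sum_eq_zero_iff_of_nonneg fun u hu => hh0 u (Finset.mem_of_mem_erase hu)).1
      (by rw [he1, hv1, sub_self])
  have hf : ∀ u ∈ F.erase v, f u = 0 := fun u hu => by
    have h1 := hzero u hu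
    have h2 := hf0 u (Finset.mem_of_mem_erase hu)
    have h3 := mul_nonneg hβ.le (hg0 u (Finset.mem_of_mem_erase hu))
    have h4 := mul_nonneg hα.le h2
    have h5 : α * f u = 0 := by simp only [hh] at h1; linarith
    exact (mul_eq_zero.1 h5).resolve_left hα.ne'
  have hkl : α • k + β • l = 0 := by
    have : ∑ u ∈ F.erase v, h u • u = 0 :=
      Finset.sum_eq_zero fun u hu => by rw [hzero u hu, zero_smul]
    simpa [this, hv1] using he
  have hk0 : k = 0 := by
    have : α • k = 0 := hK _ (smulK hα.le hk) (by
      rw [neg_eq_of_add_eq_zero_right hkl]; exact smulK hβ.le hl)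
    exact (smul_eq_zero.1 this).resolve_left hα.ne'
  have hfv : f v = 1 := by
    rw [← hf1, ← Finset.add_sum_erase F f hv, Finset.sum_eq_zero hf, add_zero]
  rw [← Finset.add_sum_erase F _ hv, hk0, hfv,
    Finset.sum_eq_zero fun u hu => by rw [hf u hu, zero_smul]]
  simp

/-- Discard redundant generators one at a time; once none is redundant, every remaining generator is
a vertex. -/
theorem convexHull_add_cone_subset_extremePoints {F : Set E} (hF : F.Finite) {K : PointedCone ℝ E}
    (hK : ∀ x ∈ K, -x ∈ K → x = 0) :
    convexHull ℝ F + (K : Set E) ⊆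
      convexHull ℝ ((convexHull ℝ F + (K : Set E)).extremePoints ℝ) + (K : Set E) := by
  classical
  lift F to Finset E using hF
  have hKconv : Convex ℝ (K : Set E) := K.convex
  induction F using Finset.strongInduction with
  | H F ih =>
    by_cases h : ∃ v ∈ F, v ∈ convexHull ℝ (F.erase v : Set E) + (K : Set E)
    · obtain ⟨v, hv, hvm⟩ := h
      have heq : convexHull ℝ (F : Set E) + (K : Set E) =
          convexHull ℝ (F.erase v : Set E) + (K : Set E) := by
        refine (?_ : _ ≤ _).antisymm
          (Set.add_subset_add_right (convexHull_mono (by simp)))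
        have : convexHull ℝ (F : Set E) ⊆ convexHull ℝ (F.erase v : Set E) + (K : Set E) := by
          refine convexHull_min (fun u hu => ?_) ((convex_convexHull ℝ _).add hKconv)
          by_cases huv : u = v
          · exact huv ▸ hvm
          · exact Set.mem_add.2 ⟨u, subset_convexHull ℝ _ (by simp [huv, Finset.mem_coe.1 hu]),
              0, K.zero_mem, add_zero u⟩
        rintro _ ⟨x, hx, k, hk, rfl⟩
        obtain ⟨y, hy, l, hl, rfl⟩ := this hx
        exact ⟨y, hy, l + k, K.add_mem hl hk, (add_assoc _ _ _).symm⟩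
      rw [heq]
      exact ih _ (Finset.erase_ssubset hv)
    · push Not at h
      exact Set.add_subset_add_right (convexHull_mono fun v hv =>
        mem_extremePoints_convexHull_add_cone hK hv (h v hv))

end ConvexGeometry

/-! ### Polyhedra and polytopes -/

section Polytope

/-- An extreme point is determined by its set of active constraints: if `x` and `y` share it, one
can move slightly from `x` away from `y` and stay feasible, which puts `x` between two feasible
points. -/
theorem finite_extremePoints_polyhedron {E ι : Type*} [AddCommGroup E] [Module ℝ E] [Finite ι]
    (l : E →ₗ[ℝ] ℝ) (b : ℝ) (a : ι → E →ₗ[ℝ] ℝ) :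
    ({x | l x = b ∧ ∀ i, 0 ≤ a i x}.extremePoints ℝ).Finite := by
  set P : Set E := {x | l x = b ∧ ∀ i, 0 ≤ a i x}
  refine Set.Finite.of_finite_image (f := fun x => {i | a i x = 0}) (Set.toFinite _) ?_
  intro x hx y hy hxy
  have hev : ∀ᶠ ε : ℝ in nhdsWithin 0 (Set.Ioi 0), ∀ i, 0 ≤ a i (x + ε • (x - y)) := by
    rw [Filter.eventually_all]
    intro i
    rcases (hx.1.2 i).eq_or_lt with h0 | h0
    · have h1 : a i y = 0 := by
        have : i ∈ {i | a i x = 0} := h0.symm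
        simpa [hxy] using this
      exact Filter.Eventually.of_forall fun ε => by simp [← h0, h1]
    · have hc : ContinuousAt (fun ε : ℝ => a i x + ε * (a i x - a i y)) 0 := by fun_prop
      have := hc.eventually (lt_mem_nhds (a := 0) (by simpa using h0))
      filter_upwards [nhdsWithin_le_nhds this] with ε hε
      simpa using hε.le
  obtain ⟨ε, hε, hε0⟩ := (hev.and self_mem_nhdsWithin).exists
  have hε0 : 0 < ε := hε0
  refine (hx.2 hy.1 (x₂ := x + ε • (x - y)) ⟨?_, hε⟩ ⟨ε / (1 + ε), 1 / (1 + ε), by positivity,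
    by positivity, by field_simp; ring, ?_⟩).symm
  · simp [hx.1.1, hy.1.1]
  · match_scalars <;> field_simp <;> ring

theorem convexHull_extremePoints_polytope {ι E : Type*} [NormedAddCommGroup E] [NormedSpace ℝ E]
    [Finite ι] (l : E →ₗ[ℝ] ℝ) (b : ℝ) (a : ι → E →ₗ[ℝ] ℝ)
    (hP : IsCompact {x | l x = b ∧ ∀ i, 0 ≤ a i x}) :
    convexHull ℝ ({x | l x = b ∧ ∀ i, 0 ≤ a i x}.extremePoints ℝ) =
      {x | l x = b ∧ ∀ i, 0 ≤ a i x} := by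
  have hconv : Convex ℝ {x | l x = b ∧ ∀ i, 0 ≤ a i x} := by
    rintro x ⟨hx, hx'⟩ y ⟨hy, hy'⟩ s t hs ht hst
    refine ⟨by simp [hx, hy, ← add_mul, hst], fun i => ?_⟩
    have h1 := mul_nonneg hs (hx' i)
    have h2 := mul_nonneg ht (hy' i)
    simpa using add_nonneg h1 h2
  have h := closure_convexHull_extremePoints hP hconv
  rwa [((finite_extremePoints_polyhedron l b a).isClosed_convexHull ℝ).closure_eq] at h

end Polytope

/-! ### Univariate quantiles as minimizers -/

namespace ConeQuantile

theorem exists_eq_lowerQuantile {N : ℕ} (hN : 0 < N) (a : Fin N → ℝ) {p : ℝ} (hp : p ≤ 1) :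
    ∃ i, a i = lowerQuantile a p :=
  (isLeast_lowerQuantile hN a hp).1.1

theorem lt_card_le_lowerQuantile {N : ℕ} (hN : 0 < N) (a : Fin N → ℝ) {p : ℝ} (hp : p ≤ 1)
    (hpN : ∀ k : ℤ, p * (N : ℝ) ≠ k) :
    p * N < ((Finset.univ.filter fun j => a j ≤ lowerQuantile a p).card : ℝ) := by
  have h := Int.ceil_le.1 (isLeast_lowerQuantile hN a hp).1.2
  rw [mul_comm] at h
  exact lt_of_le_of_ne (by exact_mod_cast h) (by exact_mod_cast hpN _)

/-- Otherwise the largest data point below the quantile would already qualify in its definition. -/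
theorem card_lt_lowerQuantile_lt {N : ℕ} (hN : 0 < N) (a : Fin N → ℝ) {p : ℝ} (hp0 : 0 < p)
    (hp : p ≤ 1) :
    ((Finset.univ.filter fun j => a j < lowerQuantile a p).card : ℝ) < p * N := by
  by_contra! h
  set F := Finset.univ.filter fun j => a j < lowerQuantile a p with hF
  have hne : F.Nonempty := by
    rw [← Finset.card_pos]
    have : (0 : ℝ) < F.card := lt_of_lt_of_le (by positivity) h
    exact_mod_cast this
  obtain ⟨i, hi, hmax⟩ := F.exists_max_image a hne
  have hlt : a i < lowerQuantile a p := (Finset.mem_filter.1 hi).2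
  refine absurd ((isLeast_lowerQuantile hN a hp).2 ⟨⟨i, rfl⟩, ?_⟩) hlt.not_ge
  have hsub : F ⊆ Finset.univ.filter fun j => a j ≤ a i := fun j hj =>
    Finset.mem_filter.2 ⟨Finset.mem_univ j, hmax j hj⟩
  rw [Int.ceil_le, mul_comm]
  exact h.trans (by exact_mod_cast Finset.card_le_card hsub)

/-- The one-sided slopes of `φ` at `q` are `#{a < q} - pN < 0` and `#{a ≤ q} - pN > 0`; the latter
is strict because `pN` is not an integer. Each summand is bounded below by its share of the
corresponding tangent line. -/
theorem quantileObjective_lowerQuantile_lt {N : ℕ} (hN : 0 < N) (a : Fin N → ℝ) {p : ℝ}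
    (hp : p ∈ Set.Ioo (0 : ℝ) 1) (hpN : ∀ k : ℤ, p * (N : ℝ) ≠ k) {t : ℝ}
    (ht : t ≠ lowerQuantile a p) :
    quantileObjective a p (lowerQuantile a p) < quantileObjective a p t := by
  obtain ⟨hp0, hp1⟩ := hp
  have hle := lt_card_le_lowerQuantile hN a hp1.le hpN
  have hlt := card_lt_lowerQuantile_lt hN a hp0 hp1.le
  set q := lowerQuantile a p
  have count : ∀ (P : Fin N → Prop) [DecidablePred P] (x : ℝ),
      ∑ i, ((if P i then x else 0) - p * x) = x * ((Finset.univ.filter P).card - p * N) := by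
    intro P _ x
    rw [Finset.sum_sub_distrib, ← Finset.sum_filter]
    simp
    ring
  rw [← sub_pos]
  unfold quantileObjective
  rw [← Finset.sum_sub_distrib]
  rcases ht.lt_or_gt with h | h
  · refine lt_of_lt_of_le ?_ (Finset.sum_le_sum (f := fun i =>
      ((if a i < q then t - q else 0) - p * (t - q))) fun i _ => ?_)
    · rw [count]
      nlinarith
    · split_ifs with hi
      · rw [max_eq_left (by linarith : a i - q ≤ 0), max_eq_right (by linarith : 0 ≤ -(a i - q))]
        nlinarith [le_max_right 0 (a i - t), le_max_right 0 (-(a i - t)),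
          mul_le_mul_of_nonneg_left (le_max_right 0 (-(a i - t))) (sub_pos.2 hp1).le,
          mul_nonneg hp0.le (le_max_left 0 (a i - t))]
      · rw [max_eq_right (by linarith : 0 ≤ a i - q), max_eq_left (by linarith : -(a i - q) ≤ 0),
          max_eq_right (by linarith : 0 ≤ a i - t), max_eq_left (by linarith : -(a i - t) ≤ 0)]
        linarith
  · refine lt_of_lt_of_le ?_ (Finset.sum_le_sum (f := fun i =>
      ((if a i ≤ q then t - q else 0) - p * (t - q))) fun i _ => ?_)
    · rw [count]
      exact mul_pos (sub_pos.2 h) (sub_pos.2 hle)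
    · split_ifs with hi
      · rw [max_eq_left (by linarith : a i - q ≤ 0), max_eq_right (by linarith : 0 ≤ -(a i - q)),
          max_eq_left (by linarith : a i - t ≤ 0), max_eq_right (by linarith : 0 ≤ -(a i - t))]
        linarith
      · rw [max_eq_right (by linarith : 0 ≤ a i - q), max_eq_left (by linarith : -(a i - q) ≤ 0)]
        nlinarith [mul_le_mul_of_nonneg_left (le_max_right 0 (a i - t)) hp0.le,
          mul_nonneg (sub_pos.2 hp1).le (le_max_left 0 (-(a i - t)))]

theorem quantileObjective_lowerQuantile_le {N : ℕ} (hN : 0 < N) (a : Fin N → ℝ) {p : ℝ}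
    (hp : p ∈ Set.Ioo (0 : ℝ) 1) (hpN : ∀ k : ℤ, p * (N : ℝ) ≠ k) (t : ℝ) :
    quantileObjective a p (lowerQuantile a p) ≤ quantileObjective a p t := by
  by_cases ht : t = lowerQuantile a p
  · rw [ht]
  · exact (quantileObjective_lowerQuantile_lt hN a hp hpN ht).le

theorem eq_lowerQuantile_of_quantileObjective_le {N : ℕ} (hN : 0 < N) (a : Fin N → ℝ) {p : ℝ}
    (hp : p ∈ Set.Ioo (0 : ℝ) 1) (hpN : ∀ k : ℤ, p * (N : ℝ) ≠ k) {t : ℝ}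
    (ht : quantileObjective a p t ≤ quantileObjective a p (lowerQuantile a p)) :
    t = lowerQuantile a p := by
  by_contra h
  exact (quantileObjective_lowerQuantile_lt hN a hp hpN h).not_ge ht

theorem quantileObjective_smul {N : ℕ} (a : Fin N → ℝ) (p t : ℝ) {r : ℝ} (hr : 0 ≤ r) :
    quantileObjective (r • a) p (r * t) = r * quantileObjective a p t := by
  unfold quantileObjective
  rw [Finset.mul_sum]
  refine Finset.sum_congr rfl fun i _ => ?_
  have h1 : max 0 (r * (a i - t)) = r * max 0 (a i - t) := by
    rw [mul_max_of_nonneg _ _ hr, mul_zero]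
  have h2 : max 0 (r * -(a i - t)) = r * max 0 (-(a i - t)) := by
    rw [mul_max_of_nonneg _ _ hr, mul_zero]
  rw [Pi.smul_apply, smul_eq_mul, ← mul_sub, ← mul_neg, h1, h2]
  ring

/-- Follows from homogeneity of `φ` and uniqueness of its minimizer, without counting. -/
theorem lowerQuantile_smul {N : ℕ} (hN : 0 < N) (a : Fin N → ℝ) {p : ℝ}
    (hp : p ∈ Set.Ioo (0 : ℝ) 1) (hpN : ∀ k : ℤ, p * (N : ℝ) ≠ k) {r : ℝ} (hr : 0 < r) :
    lowerQuantile (r • a) p = r * lowerQuantile a p := by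
  symm
  refine eq_lowerQuantile_of_quantileObjective_le hN _ hp hpN ?_
  have h : lowerQuantile (r • a) p = r * (r⁻¹ * lowerQuantile (r • a) p) := by
    rw [mul_inv_cancel_left₀ hr.ne']
  rw [h, quantileObjective_smul _ _ _ hr.le, quantileObjective_smul _ _ _ hr.le]
  exact mul_le_mul_of_nonneg_left (quantileObjective_lowerQuantile_le hN a hp hpN _) hr.le

theorem quantileObjective_convex {N : ℕ} {p : ℝ} (hp : p ∈ Set.Ioo (0 : ℝ) 1) (a b : Fin N → ℝ)
    (s t : ℝ) {α β : ℝ} (hα : 0 ≤ α) (hβ : 0 ≤ β) :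
    quantileObjective (α • a + β • b) p (α * s + β * t) ≤
      α * quantileObjective a p s + β * quantileObjective b p t := by
  unfold quantileObjective
  rw [Finset.mul_sum, Finset.mul_sum, ← Finset.sum_add_distrib]
  refine Finset.sum_le_sum fun i _ => ?_
  have h1 : max 0 ((α • a + β • b) i - (α * s + β * t)) ≤
      α * max 0 (a i - s) + β * max 0 (b i - t) := by
    refine max_le (by positivity) ?_
    have h3 := mul_le_mul_of_nonneg_left (le_max_right 0 (a i - s)) hα
    have h4 := mul_le_mul_of_nonneg_left (le_max_right 0 (b i - t)) hβ
    simp only [Pi.add_apply, Pi.smul_apply, smul_eq_mul]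
    linarith
  have h2 : max 0 (-((α • a + β • b) i - (α * s + β * t))) ≤
      α * max 0 (-(a i - s)) + β * max 0 (-(b i - t)) := by
    refine max_le (by positivity) ?_
    have h3 := mul_le_mul_of_nonneg_left (le_max_right 0 (-(a i - s))) hα
    have h4 := mul_le_mul_of_nonneg_left (le_max_right 0 (-(b i - t))) hβ
    simp only [Pi.add_apply, Pi.smul_apply, smul_eq_mul]
    linarith
  have h3 := mul_le_mul_of_nonneg_left h1 hp.1.le
  have h4 := mul_le_mul_of_nonneg_left h2 (sub_pos.2 hp.2).le
  linarith

end ConeQuantile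

/-! ### Convexity of the extended image and boundedness of the base -/

namespace ConeQuantile

variable {N n : ℕ}

/-- `dualOrderingCone` as a pointed cone. -/
def dualOrderingPointedCone (n : ℕ) : PointedCone ℝ (Fin (n + 1) → ℝ) where
  carrier := dualOrderingCone n
  zero_mem' := ⟨fun _ => rfl, le_rfl⟩
  add_mem' := fun ha hb => ⟨fun j => by simp [ha.1 j, hb.1 j], add_nonneg ha.2 hb.2⟩
  smul_mem' := fun r _ ha => ⟨fun j => by
    rw [Pi.smul_apply, ha.1 j, smul_zero], mul_nonneg r.2 ha.2⟩

theorem eq_zero_of_mem_dualOrderingPointedCone {x : Fin (n + 1) → ℝ}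
    (hx : x ∈ dualOrderingPointedCone n) (hx' : -x ∈ dualOrderingPointedCone n) : x = 0 := by
  obtain ⟨h1, h2⟩ := hx
  obtain ⟨-, h3⟩ := hx'
  ext j
  refine Fin.lastCases ?_ (fun j => ?_) j
  · exact le_antisymm (by simpa using h3) h2
  · exact h1 j

theorem mem_dualObjective_image_add_iff (X : Fin N → Fin (n + 1) → ℝ) (p : ℝ)
    (c : Fin (n + 1) → ℝ) (U : Set ((Fin (n + 1) → ℝ) × ℝ)) (y : Fin (n + 1) → ℝ) :
    y ∈ dualObjective X p c '' U + dualOrderingCone n ↔ ∃ w t, (w, t) ∈ U ∧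
      (∀ j : Fin n, y j.castSucc = c (Fin.last n) / |c (Fin.last n)| * w j.castSucc) ∧
      quantileObjective (scalarData X w) p t ≤ y (Fin.last n) := by
  constructor
  · rintro ⟨_, ⟨⟨w, t⟩, ha, rfl⟩, k, ⟨hk, hk'⟩, rfl⟩
    exact ⟨w, t, ha, fun j => by simp [dualObjective, hk], by simpa [dualObjective] using hk'⟩
  · rintro ⟨w, t, ha, h1, h2⟩
    refine ⟨_, ⟨(w, t), ha, rfl⟩, y - dualObjective X p c (w, t), ⟨fun j => ?_, ?_⟩, by simp⟩
    · simp [dualObjective, h1]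
    · simpa [dualObjective] using h2

theorem scalarData_combo (X : Fin N → Fin (n + 1) → ℝ) (v w : Fin (n + 1) → ℝ) (α β : ℝ) :
    scalarData X (α • v + β • w) = α • scalarData X v + β • scalarData X w := by
  ext i
  simp [scalarData]

/-- Stated for any convex `U`, since it serves both the whole feasible set and its part where `t ≤
wᵀz`. -/
theorem convex_dualObjective_image_add (X : Fin N → Fin (n + 1) → ℝ) {p : ℝ}
    (hp : p ∈ Set.Ioo (0 : ℝ) 1) (c : Fin (n + 1) → ℝ) {U : Set ((Fin (n + 1) → ℝ) × ℝ)}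
    (hU : Convex ℝ U) : Convex ℝ (dualObjective X p c '' U + dualOrderingCone n) := by
  intro y hy z hz α β hα hβ hαβ
  rw [mem_dualObjective_image_add_iff] at hy hz ⊢
  obtain ⟨v, s, ha, hv, hs⟩ := hy
  obtain ⟨w, t, hb, hw, ht⟩ := hz
  refine ⟨α • v + β • w, α * s + β * t, hU ha hb hα hβ hαβ, fun j => ?_, ?_⟩
  · simp only [Pi.add_apply, Pi.smul_apply, smul_eq_mul, hv, hw]
    ring
  · simp only [scalarData_combo]
    refine (quantileObjective_convex hp _ _ s t hα hβ).trans ?_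
    simp only [Pi.add_apply, Pi.smul_apply, smul_eq_mul]
    gcongr

theorem convex_dualBase (C : Set (Fin (n + 1) → ℝ)) (c : Fin (n + 1) → ℝ) :
    Convex ℝ (dualBase C c) := by
  rintro v ⟨hv, hv'⟩ w ⟨hw, hw'⟩ α β hα hβ hαβ
  refine ⟨fun z hz => ?_, by simp [hv', hw', hαβ]⟩
  have h1 := mul_nonneg hα (hv z hz)
  have h2 := mul_nonneg hβ (hw z hz)
  simpa using add_nonneg h1 h2

theorem convex_dualFeasible (C : Set (Fin (n + 1) → ℝ)) (c : Fin (n + 1) → ℝ) :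
    Convex ℝ (dualFeasible C c) :=
  (convex_dualBase C c).prod convex_univ

theorem eq_of_castSucc_eq {c v w : Fin (n + 1) → ℝ} (hcd : c (Fin.last n) ≠ 0)
    (hvw : c ⬝ᵥ v = c ⬝ᵥ w)
    (h : ∀ j : Fin n, c (Fin.last n) / |c (Fin.last n)| * v j.castSucc =
      c (Fin.last n) / |c (Fin.last n)| * w j.castSucc) : v = w := by
  have hne : c (Fin.last n) / |c (Fin.last n)| ≠ 0 := div_ne_zero hcd (abs_ne_zero.2 hcd)
  have h' : ∀ j : Fin n, v j.castSucc = w j.castSucc := fun j => mul_left_cancel₀ hne (h j)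
  ext j
  refine Fin.lastCases ?_ h' j
  simp only [dotProduct, Fin.sum_univ_castSucc, h'] at hvw
  exact mul_left_cancel₀ hcd (add_left_cancel hvw)

theorem exists_pos_forall_mul_abs_le {C : Set (Fin (n + 1) → ℝ)} {c : Fin (n + 1) → ℝ}
    (hc : c ∈ interior C) :
    ∃ ε > 0, ∀ w ∈ dualCone C, ∀ j, ε * |w j| ≤ c ⬝ᵥ w := by
  obtain ⟨δ, hδ, hball⟩ := Metric.isOpen_iff.1 isOpen_interior c hc
  refine ⟨δ / 2, by positivity, fun w hw j => ?_⟩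
  -- Test `w` against `c ± (δ/2) e_j`, which stay inside the ball around `c`.
  have key : ∀ s : ℝ, |s| = δ / 2 → 0 ≤ c ⬝ᵥ w + s * w j := by
    intro s hs
    have hmem : c + Pi.single j s ∈ C := interior_subset (hball (by
      rw [mem_ball_iff_norm, add_sub_cancel_left, Pi.norm_single, Real.norm_eq_abs, hs]
      linarith))
    have := hw _ hmem
    rwa [dotProduct_add, dotProduct_single, dotProduct_comm, mul_comm (w j)] at this
  have h1 := key (δ / 2) (abs_of_pos (by positivity))
  have h2 := key (-(δ / 2)) (by rw [abs_neg, abs_of_pos (by positivity)])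
  rcases abs_choice (w j) with h | h <;> rw [h] <;> linarith

theorem isBounded_dualBase {C : Set (Fin (n + 1) → ℝ)} {c : Fin (n + 1) → ℝ}
    (hc : c ∈ interior C) : Bornology.IsBounded (dualBase C c) := by
  obtain ⟨ε, hε, h⟩ := exists_pos_forall_mul_abs_le hc
  refine (Metric.isBounded_closedBall (x := 0) (r := ε⁻¹)).subset fun w hw => ?_
  rw [mem_closedBall_zero_iff, pi_norm_le_iff_of_nonneg (by positivity)]
  intro j
  have := h w hw.1 j
  rw [hw.2] at this
  rwa [Real.norm_eq_abs, ← one_div, le_div_iff₀' hε]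

theorem dotProduct_pos_of_mem_dualCone {C : Set (Fin (n + 1) → ℝ)} {c w : Fin (n + 1) → ℝ}
    (hc : c ∈ interior C) (hw : w ∈ dualCone C) (hw0 : w ≠ 0) : 0 < c ⬝ᵥ w := by
  obtain ⟨ε, hε, h⟩ := exists_pos_forall_mul_abs_le hc
  obtain ⟨j, hj⟩ := Function.ne_iff.1 hw0
  exact lt_of_lt_of_le (mul_pos hε (abs_pos.2 hj)) (h w hw j)

/-! ### Order cells and polyhedrality of the extended image -/

/-- The weights in the base of the dual cone which order the data compatibly with `R`. -/
def orderCell (X : Fin N → Fin (n + 1) → ℝ) (C : Set (Fin (n + 1) → ℝ)) (c : Fin (n + 1) → ℝ)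
    (R : Set (Fin N × Fin N)) : Set (Fin (n + 1) → ℝ) :=
  {w ∈ dualBase C c | ∀ jk ∈ R, scalarData X w jk.1 ≤ scalarData X w jk.2}

theorem orderCell_extremePoints (X : Fin N → Fin (n + 1) → ℝ) {C : Set (Fin (n + 1) → ℝ)}
    (hC : IsPolyhedralCone C) {c : Fin (n + 1) → ℝ} (hc : c ∈ interior C)
    (R : Set (Fin N × Fin N)) :
    ((orderCell X C c R).extremePoints ℝ).Finite ∧
      convexHull ℝ ((orderCell X C c R).extremePoints ℝ) = orderCell X C c R := by
  obtain ⟨r, Y, rfl⟩ := hC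
  set l := dotProductBilin ℝ ℝ c
  set a : Fin r ⊕ R → (Fin (n + 1) → ℝ) →ₗ[ℝ] ℝ :=
    Sum.elim (fun i => dotProductBilin ℝ ℝ (Y i))
      (fun jk => dotProductBilin ℝ ℝ (X jk.1.2 - X jk.1.1))
  have heq : orderCell X (rowCone Y) c R = {w | l w = 1 ∧ ∀ i, 0 ≤ a i w} := by
    ext w
    simp only [orderCell, dualBase, dualCone_rowCone, Set.mem_ofPred_eq, Sum.forall, a, l,
      Sum.elim_inl, Sum.elim_inr, dotProductBilin_apply_apply, sub_dotProduct, sub_nonneg,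
      scalarData, dotProduct_comm w, Subtype.forall, Pi.le_def]
    exact ⟨fun h => ⟨h.1.2, h.1.1, h.2⟩, fun h => ⟨⟨h.2.1, h.1⟩, h.2.2⟩⟩
  have hcomp : IsCompact {w | l w = 1 ∧ ∀ i, 0 ≤ a i w} := by
    refine Metric.isCompact_of_isClosed_isBounded ?_
      (heq ▸ (isBounded_dualBase hc).subset fun w hw => hw.1)
    rw [Set.ofPred_and, Set.ofPred_forall]
    exact (isClosed_eq l.continuous_of_finiteDimensional continuous_const).inter
      (isClosed_iInter fun i =>
        isClosed_le continuous_const (a i).continuous_of_finiteDimensional)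
  rw [heq]
  exact ⟨finite_extremePoints_polyhedron l 1 a, convexHull_extremePoints_polytope l 1 a hcomp⟩

/-- Within a cell the sign of each `wᵀxᵏ - wᵀxⁱ` is fixed, so every positive and negative part is
linear in `w`. -/
theorem exists_linearMap_eqOn_orderCell (X : Fin N → Fin (n + 1) → ℝ) (p : ℝ)
    (C : Set (Fin (n + 1) → ℝ)) (c v : Fin (n + 1) → ℝ) (i : Fin N) :
    ∃ M : (Fin (n + 1) → ℝ) →ₗ[ℝ] (Fin (n + 1) → ℝ),
      ∀ w ∈ orderCell X C c {jk | scalarData X v jk.1 ≤ scalarData X v jk.2},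
        M w = dualObjective X p c (w, scalarData X w i) := by
  classical
  refine ⟨LinearMap.pi (Fin.lastCases (∑ j, if scalarData X v j ≤ scalarData X v i then
      (1 - p) • dotProductBilin ℝ ℝ (X i - X j) else p • dotProductBilin ℝ ℝ (X j - X i))
    fun j => (c (Fin.last n) / |c (Fin.last n)|) • LinearMap.proj j.castSucc), fun w hw => ?_⟩
  ext j
  refine Fin.lastCases ?_ (fun j => ?_) j
  · simp only [LinearMap.pi_apply, Fin.lastCases_last, dualObjective, Fin.snoc_last,
      quantileObjective, LinearMap.sum_apply]
    refine Finset.sum_congr rfl fun k _ => ?_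
    split_ifs with h
    · have h' : scalarData X w k ≤ scalarData X w i := hw.2 (k, i) h
      rw [max_eq_left (by linarith), max_eq_right (by linarith)]
      simp [scalarData, dotProduct_comm w]
    · have h' : scalarData X w i ≤ scalarData X w k := hw.2 (i, k) (le_of_not_ge h)
      rw [max_eq_right (by linarith), max_eq_left (by linarith)]
      simp [scalarData, dotProduct_comm w]
  · simp [dualObjective]

theorem exists_finite_extendedImage_eq (X : Fin N → Fin (n + 1) → ℝ) {p : ℝ} (hN : 0 < N)
    (hp : p ∈ Set.Ioo (0 : ℝ) 1) (hpN : ∀ k : ℤ, p * (N : ℝ) ≠ k)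
    {C : Set (Fin (n + 1) → ℝ)} (hC : IsPolyhedralCone C)
    {c : Fin (n + 1) → ℝ} (hc : c ∈ interior C) :
    ∃ F : Set (Fin (n + 1) → ℝ), F.Finite ∧
      extendedImage X p C c = convexHull ℝ F + (dualOrderingPointedCone n : Set _) := by
  set q : (Fin (n + 1) → ℝ) → ℝ := fun w => lowerQuantile (scalarData X w) p with hq
  set V : Set (Fin (n + 1) → ℝ) := ⋃ R, (orderCell X C c R).extremePoints ℝ with hV
  set F := (fun w => dualObjective X p c (w, q w)) '' V
  have hVB : V ⊆ dualBase C c := Set.iUnion_subset fun R w hw => hw.1.1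
  have hVfin : V.Finite := Set.finite_iUnion fun R => (orderCell_extremePoints X hC hc R).1
  have hFK : Convex ℝ (convexHull ℝ F + (dualOrderingPointedCone n : Set _)) :=
    (convex_convexHull ℝ F).add (dualOrderingPointedCone n).convex
  -- Replacing `q w` by any other `t` only raises the last coordinate.
  have hup : ∀ w t k, dualObjective X p c (w, q w) ∈
      convexHull ℝ F + (dualOrderingPointedCone n : Set _) → k ∈ dualOrderingCone n →
      dualObjective X p c (w, t) + k ∈ convexHull ℝ F + (dualOrderingPointedCone n : Set _) := by
    rintro w t k ⟨f, hf, l, hl, hfl⟩ hk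
    refine ⟨f, hf, l + (dualObjective X p c (w, t) - dualObjective X p c (w, q w) + k),
      add_mem hl (add_mem (⟨fun j => by simp [dualObjective], ?_⟩) hk), ?_⟩
    · simpa [dualObjective] using quantileObjective_lowerQuantile_le hN _ hp hpN t
    · simp only at hfl ⊢
      rw [← add_assoc, ← add_assoc, hfl]
      abel
  refine ⟨F, hVfin.image _, Set.Subset.antisymm ?_ ?_⟩
  · rintro _ ⟨_, ⟨⟨v, t⟩, ⟨hv, -⟩, rfl⟩, k, hk, rfl⟩
    refine hup v t k ?_ hk
    obtain ⟨i, hi⟩ := exists_eq_lowerQuantile hN (scalarData X v) hp.2.le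
    obtain ⟨M, hM⟩ := exists_linearMap_eqOn_orderCell X p C c v i
    set P := orderCell X C c {jk | scalarData X v jk.1 ≤ scalarData X v jk.2}
    have hvP : v ∈ P := ⟨hv, fun jk h => h⟩
    have hMv : M v ∈ convexHull ℝ (M '' P.extremePoints ℝ) := by
      rw [← LinearMap.image_convexHull, (orderCell_extremePoints X hC hc _).2]
      exact Set.mem_image_of_mem _ hvP
    have hqv : q v = scalarData X v i := hi.symm
    rw [hqv, ← hM v hvP]
    refine convexHull_min ?_ hFK hMv
    rintro _ ⟨w, hw, rfl⟩
    -- The index `i` realizes the quantile at `v` but perhaps not at the cell vertex `w`; `hup`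
    -- absorbs the difference.
    rw [hM w hw.1, ← add_zero (dualObjective X p c _)]
    refine hup w _ 0 ?_ (dualOrderingPointedCone n).zero_mem
    exact ⟨_, subset_convexHull ℝ F ⟨w, Set.mem_iUnion.2 ⟨_, hw⟩, rfl⟩, 0, zero_mem _, add_zero _⟩
  · have hsub : convexHull ℝ F ⊆ extendedImage X p C c := by
      refine convexHull_min ?_ (convex_dualObjective_image_add X hp c (convex_dualFeasible C c))
      rintro _ ⟨w, hw, rfl⟩
      exact ⟨_, ⟨(w, q w), ⟨hVB hw, trivial⟩, rfl⟩, 0,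
        (dualOrderingPointedCone n).zero_mem, add_zero _⟩
    rintro _ ⟨f, hf, k, hk, rfl⟩
    obtain ⟨g, hg, l, hl, rfl⟩ := hsub hf
    exact ⟨g, hg, l + k, (dualOrderingPointedCone n).add_mem hl hk, (add_assoc _ _ _).symm⟩

/-! ### The unique irredundant solution and the quantile formula -/

/-- The feasible points whose objective value is a vertex of the extended image. -/
def vertexSolution (X : Fin N → Fin (n + 1) → ℝ) (p : ℝ) (C : Set (Fin (n + 1) → ℝ))
    (c : Fin (n + 1) → ℝ) : Set ((Fin (n + 1) → ℝ) × ℝ) :=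
  {a ∈ dualFeasible C c | dualObjective X p c a ∈ (extendedImage X p C c).extremePoints ℝ}

theorem snd_eq_lowerQuantile_of_mem_vertexSolution {X : Fin N → Fin (n + 1) → ℝ} {p : ℝ}
    (hN : 0 < N) (hp : p ∈ Set.Ioo (0 : ℝ) 1) (hpN : ∀ k : ℤ, p * (N : ℝ) ≠ k)
    {C : Set (Fin (n + 1) → ℝ)} {c : Fin (n + 1) → ℝ} {a : (Fin (n + 1) → ℝ) × ℝ}
    (ha : a ∈ vertexSolution X p C c) : a.2 = lowerQuantile (scalarData X a.1) p := by
  obtain ⟨w, t⟩ := a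
  obtain ⟨⟨hw, -⟩, hext⟩ := ha
  set q := lowerQuantile (scalarData X w) p
  set k := dualObjective X p c (w, t) - dualObjective X p c (w, q) with hkdef
  have hk : k ∈ dualOrderingPointedCone n := by
    refine ⟨fun j => by simp [k, dualObjective], ?_⟩
    simpa [k, dualObjective] using quantileObjective_lowerQuantile_le hN _ hp hpN t
  have hwq : dualObjective X p c (w, q) ∈ dualObjective X p c '' dualFeasible C c :=
    ⟨(w, q), ⟨hw, trivial⟩, rfl⟩
  have h0 : k = 0 := eq_zero_of_add_mem_extremePoints (A := extendedImage X p C c)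
    (a := dualObjective X p c (w, q))
    ⟨_, hwq, 0, (dualOrderingPointedCone n).zero_mem, add_zero _⟩
    ⟨_, hwq, _, (dualOrderingPointedCone n).smul_mem zero_le_two hk, rfl⟩
    (by rwa [hkdef, add_sub_cancel])
  have h1 := congrFun h0 (Fin.last n)
  simp only [k, dualObjective, Pi.sub_apply, Fin.snoc_last, Pi.zero_apply] at h1
  exact eq_lowerQuantile_of_quantileObjective_le hN _ hp hpN (sub_eq_zero.1 h1).le

theorem injOn_dualObjective_vertexSolution {X : Fin N → Fin (n + 1) → ℝ} {p : ℝ}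
    (hN : 0 < N) (hp : p ∈ Set.Ioo (0 : ℝ) 1) (hpN : ∀ k : ℤ, p * (N : ℝ) ≠ k)
    {C : Set (Fin (n + 1) → ℝ)} {c : Fin (n + 1) → ℝ} (hcd : c (Fin.last n) ≠ 0) :
    Set.InjOn (dualObjective X p c) (vertexSolution X p C c) := by
  intro a ha b hb hab
  have h1 : a.1 = b.1 := eq_of_castSucc_eq hcd (ha.1.1.2.trans hb.1.1.2.symm) fun j => by
    simpa [dualObjective] using congrFun hab j.castSucc
  refine Prod.ext h1 ?_
  rw [snd_eq_lowerQuantile_of_mem_vertexSolution hN hp hpN ha,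
    snd_eq_lowerQuantile_of_mem_vertexSolution hN hp hpN hb, h1]

theorem extremePoints_extendedImage_subset (X : Fin N → Fin (n + 1) → ℝ) (p : ℝ)
    (C : Set (Fin (n + 1) → ℝ)) (c : Fin (n + 1) → ℝ) :
    (extendedImage X p C c).extremePoints ℝ ⊆ dualObjective X p c '' vertexSolution X p C c := by
  intro y hy
  obtain ⟨_, ⟨a, ha, rfl⟩, k, hk, rfl⟩ := hy.1
  have hmem : dualObjective X p c a ∈ dualObjective X p c '' dualFeasible C c := ⟨a, ha, rfl⟩
  have h0 : k = 0 := eq_zero_of_add_mem_extremePoints (A := extendedImage X p C c)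
    ⟨_, hmem, 0, (dualOrderingPointedCone n).zero_mem, add_zero _⟩
    ⟨_, hmem, _, (dualOrderingPointedCone n).smul_mem zero_le_two hk, rfl⟩ hy
  subst h0
  simp only [add_zero] at hy ⊢
  exact ⟨a, ⟨ha, hy⟩, rfl⟩

/-- By injectivity each vertex has one feasible preimage, which no solution can omit; any other
point can be dropped. -/
theorem isIrredundantDualSolution_iff {X : Fin N → Fin (n + 1) → ℝ} {p : ℝ}
    (hN : 0 < N) (hp : p ∈ Set.Ioo (0 : ℝ) 1) (hpN : ∀ k : ℤ, p * (N : ℝ) ≠ k)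
    {C : Set (Fin (n + 1) → ℝ)} (hC : IsPolyhedralCone C)
    {c : Fin (n + 1) → ℝ} (hc : c ∈ interior C) (hcd : c (Fin.last n) ≠ 0)
    {S : Set ((Fin (n + 1) → ℝ) × ℝ)} :
    IsIrredundantDualSolution X p C c S ↔ S = vertexSolution X p C c := by
  have hinj := injOn_dualObjective_vertexSolution (X := X) hN hp hpN (C := C) hcd
  have hsub := extremePoints_extendedImage_subset X p C c
  constructor
  · rintro ⟨⟨hfin, hfeas, hcov⟩, hirr⟩
    refine Set.Subset.antisymm (fun a ha => ?_) (fun a ha => ?_)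
    · by_contra hna
      refine hirr a ha ⟨hfin.sdiff, Set.sdiff_subset.trans hfeas, fun y hy => ?_⟩
      obtain ⟨b, hb, rfl⟩ := hcov hy
      refine ⟨b, ⟨hb, fun hba => hna ?_⟩, rfl⟩
      rw [← Set.mem_singleton_iff.1 hba]
      exact ⟨hfeas hb, hy⟩
    · obtain ⟨b, hb, hba⟩ := hcov ha.2
      have hb' : b ∈ vertexSolution X p C c := ⟨hfeas hb, hba ▸ ha.2⟩
      rwa [← hinj hb' ha hba]
  · rintro rfl
    refine ⟨⟨Set.Finite.of_finite_image ?_ hinj, fun a ha => ha.1, hsub⟩, ?_⟩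
    · obtain ⟨F, hF, hFeq⟩ := exists_finite_extendedImage_eq X hN hp hpN hC hc
      refine hF.subset ?_
      rintro _ ⟨a, ha, rfl⟩
      refine extremePoints_convexHull_add_cone_subset (dualOrderingPointedCone n) ?_
      rw [← hFeq]
      exact ha.2
    · rintro a ha ⟨-, -, hcov⟩
      obtain ⟨b, hb, hba⟩ := hcov ha.2
      exact hb.2 (hinj hb.1 ha hba)

theorem lowerQuantile_le_of_forall_mem_vertexSolution {X : Fin N → Fin (n + 1) → ℝ} {p : ℝ}
    (hN : 0 < N) (hp : p ∈ Set.Ioo (0 : ℝ) 1) (hpN : ∀ k : ℤ, p * (N : ℝ) ≠ k)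
    {C : Set (Fin (n + 1) → ℝ)} (hC : IsPolyhedralCone C)
    {c : Fin (n + 1) → ℝ} (hc : c ∈ interior C) (hcd : c (Fin.last n) ≠ 0)
    {z : Fin (n + 1) → ℝ} (hz : ∀ a ∈ vertexSolution X p C c, a.2 ≤ a.1 ⬝ᵥ z)
    {w : Fin (n + 1) → ℝ} (hw : w ∈ dualBase C c) :
    lowerQuantile (scalarData X w) p ≤ w ⬝ᵥ z := by
  set U : Set ((Fin (n + 1) → ℝ) × ℝ) := {a ∈ dualFeasible C c | a.2 ≤ a.1 ⬝ᵥ z}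
  have hU : Convex ℝ U := by
    rintro a ⟨ha, ha'⟩ b ⟨hb, hb'⟩ α β hα hβ hαβ
    refine ⟨convex_dualFeasible C c ha hb hα hβ hαβ, ?_⟩
    have h1 := mul_le_mul_of_nonneg_left ha' hα
    have h2 := mul_le_mul_of_nonneg_left hb' hβ
    simpa using add_le_add h1 h2
  obtain ⟨F, hF, hFeq⟩ := exists_finite_extendedImage_eq X hN hp hpN hC hc
  have hhull := convexHull_add_cone_subset_extremePoints (K := dualOrderingPointedCone n) hF
    fun x hx hx' => eq_zero_of_mem_dualOrderingPointedCone hx hx'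
  rw [← hFeq] at hhull
  have hsub : convexHull ℝ ((extendedImage X p C c).extremePoints ℝ) ⊆
      dualObjective X p c '' U + dualOrderingCone n := by
    refine convexHull_min (fun y hy => ?_) (convex_dualObjective_image_add X hp c hU)
    obtain ⟨a, ha, rfl⟩ := extremePoints_extendedImage_subset X p C c hy
    exact ⟨_, ⟨a, ⟨ha.1, hz a ha⟩, rfl⟩, 0, (dualOrderingPointedCone n).zero_mem, add_zero _⟩
  have hmem : dualObjective X p c (w, lowerQuantile (scalarData X w) p) ∈
      dualObjective X p c '' U + dualOrderingCone n := by
    obtain ⟨y, hy, k, hk, hyk⟩ := hhull (a := dualObjective X p c (w, _))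
      ⟨_, ⟨(w, lowerQuantile (scalarData X w) p), ⟨hw, trivial⟩, rfl⟩, 0,
        (dualOrderingPointedCone n).zero_mem, add_zero _⟩
    obtain ⟨u, hu, l, hl, rfl⟩ := hsub hy
    exact ⟨u, hu, l + k, (dualOrderingPointedCone n).add_mem hl hk,
      (add_assoc _ _ _).symm.trans hyk⟩
  obtain ⟨v, t, ⟨⟨hv, -⟩, htz⟩, h1, h2⟩ := (mem_dualObjective_image_add_iff _ _ _ _ _).1 hmem
  have hvw : w = v := eq_of_castSucc_eq hcd (hw.2.trans hv.2.symm) fun j => by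
    -- Equal first coordinates and the normalization `cᵀw = 1` force equal weights.
    simpa [dualObjective] using h1 j
  subst hvw
  have ht : t = lowerQuantile (scalarData X w) p :=
    eq_lowerQuantile_of_quantileObjective_le hN _ hp hpN (by simpa [dualObjective] using h2)
  rw [← ht]
  exact htz

theorem lowerConeQuantile_eq_iInter_vertexSolution {X : Fin N → Fin (n + 1) → ℝ} {p : ℝ}
    (hN : 0 < N) (hp : p ∈ Set.Ioo (0 : ℝ) 1) (hpN : ∀ k : ℤ, p * (N : ℝ) ≠ k)
    {C : Set (Fin (n + 1) → ℝ)} (hC : IsPolyhedralCone C)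
    {c : Fin (n + 1) → ℝ} (hc : c ∈ interior C) (hcd : c (Fin.last n) ≠ 0) :
    lowerConeQuantile X C p = ⋂ a ∈ vertexSolution X p C c, {z | a.2 ≤ a.1 ⬝ᵥ z} := by
  ext z
  simp only [lowerConeQuantile, Set.mem_iInter, Set.mem_ofPred_eq]
  constructor
  · intro h a ha
    rw [snd_eq_lowerQuantile_of_mem_vertexSolution hN hp hpN ha]
    exact h a.1 ha.1.1.1
  · intro h w hw
    by_cases hw0 : w = 0
    -- The weight 0 cannot be scaled into the base, but its data and hence its quantile vanish.
    · obtain ⟨i, hi⟩ := exists_eq_lowerQuantile hN (scalarData X w) hp.2.le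
      rw [← hi, hw0]
      simp [scalarData]
    · have hpos := dotProduct_pos_of_mem_dualCone hc hw hw0
      have hbase : (c ⬝ᵥ w)⁻¹ • w ∈ dualBase C c := by
        refine ⟨fun y hy => ?_, ?_⟩
        · rw [smul_dotProduct]
          exact mul_nonneg (inv_nonneg.2 hpos.le) (hw y hy)
        · rw [dotProduct_smul, smul_eq_mul, inv_mul_cancel₀ hpos.ne']
      have := lowerQuantile_le_of_forall_mem_vertexSolution hN hp hpN hC hc hcd h hbase
      have hs : scalarData X ((c ⬝ᵥ w)⁻¹ • w) = (c ⬝ᵥ w)⁻¹ • scalarData X w := by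
        ext i
        simp [scalarData]
      rw [hs, lowerQuantile_smul hN _ hp hpN (inv_pos.2 hpos), smul_dotProduct, smul_eq_mul] at this
      exact le_of_mul_le_mul_left this (inv_pos.2 hpos)

end ConeQuantile

open ConeQuantile
theorem mainTheorem1 {N n : ℕ} (X : Fin N → Fin (n + 1) → ℝ) (p : ℝ)
    (hp : p ∈ Set.Ioo (0 : ℝ) 1) (hpN : ∀ k : ℤ, p * (N : ℝ) ≠ (k : ℝ))
    (C : Set (Fin (n + 1) → ℝ)) (hC : IsPolyhedralCone C) (hline : IsLineFree C)
    (c : Fin (n + 1) → ℝ) (hc : c ∈ interior C) (hcd : c (Fin.last n) ≠ 0) :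
    (∃! S : Set ((Fin (n + 1) → ℝ) × ℝ), IsIrredundantDualSolution X p C c S) ∧
      ∀ S : Set ((Fin (n + 1) → ℝ) × ℝ), IsIrredundantDualSolution X p C c S →
        lowerConeQuantile X C p = ⋂ a ∈ S, {z | a.2 ≤ a.1 ⬝ᵥ z} := by
  -- For `N = 0` the product `pN` would be the integer 0.
  have hN : 0 < N := Nat.pos_of_ne_zero fun h => hpN 0 (by simp [h])
  have key : ∀ S, IsIrredundantDualSolution X p C c S ↔ S = vertexSolution X p C c := fun S =>
    isIrredundantDualSolution_iff hN hp hpN hC hc hcd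
  refine ⟨⟨_, (key _).2 rfl, fun S hS => (key S).1 hS⟩, fun S hS => ?_⟩
  rw [(key S).1 hS]
  exact lowerConeQuantile_eq_iInter_vertexSolution hN hp hpN hC hc hcd
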